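/- Let $A$ be a finite alphabet. A word $u$ is a \emph{piece} of a word $v$ if $u$ is a (scattered) subword of $v$, that is, $u=b_1\cdots b_k$ with $b_i\in A$ and $v\in A^*b_1A^*\cdots A^*b_kA^*$; its size is $k$. For $\kappa\in\mathbb N$ write $w\sim_\kappa w'$ if $w,w'\in A^*$ have the same pieces of size at most $\kappa$. Let $PT[\kappa]$ be the class of languages over $A$ that are unions of $\sim_j$-classes for some $j\le\kappa$, and let $PT=\bigcup_\kappa PT[\kappa]$ be the class of piecewise testable languages. A language $L$ \emph{separates} $L_1$ from $L_2$ if $L_1\subseteq L$ and $L\cap L_2=\varnothing$; $L_1$ and $L_2$ are \emph{$\mathcal C$-separable} if some $L\in\mathcal C$ separates $L_1$ from $L_2$. The \emph{$\kappa$-piece closure} of $L$ is $[L]_\kappa=\{w\in A^*\mid \exists u\in L,\ u\sim_\kappa w\}$. A \emph{factorization pair} $(\vec u,\vec B)$ consists, for some $n\ge 0$, of words $\vec u=(u_0,\dots,u_n)$ over $A$ and nonempty subsets $\vec B=(B_1,\dots,B_n)$ of $A$. A \emph{$(\vec u,\vec B)$-path} in a nondeterministic finite automaton (NFA) over $A$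 is a path from an initial state to a final state of the form $$s_0\xrightarrow{u_0}t_0\xrightarrow{\subseteq B_1}r_1\xrightarrow{=B_1}r_1\xrightarrow{\subseteq B_1}s_1\xrightarrow{u_1}t_1\ \cdots\ t_{n-1}\xrightarrow{\subseteq B_n}r_n\xrightarrow{=B_n}r_n\xrightarrow{\subseteq B_n}s_n\xrightarrow{u_n}t_n ,$$ where $\xrightarrow{u}$ is a path labeled $u$, $\xrightarrow{\subseteq B}$ is a (possibly empty) path all of whose labels lie in $B$, and $\xrightarrow{=B}$ is such a path along which every letter of $B$ occurs. \textbf{Theorem.} Let $\mathcal A_1,\mathcal A_2$ be NFAs over $A$ (without $\varepsilon$-transitions) with $k_1$ and $k_2$ states, recognizing the languages $L_1$ and $L_2$. Put $p=\max(k_1,k_2)+1$ and $\kappa=p\,|A|\,2^{2^{|A|}|A|(p|A|+1)}$. The following conditions are equivalent: (1) $L_1$ and $L_2$ are $PT$-separable; (2) $L_1$ and $L_2$ are $PT[\kappa]$-separable; (3) the $\kappa$-piece closure $[L_1]_\kappa$ separates $L_1$ from $L_2$; (4) there is no factorization pair $(\vec u,\vec B)$ such that both $\mathcal A_1$ and $\mathcal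 A_2$ have a $(\vec u,\vec B)$-path. -/

import Mathlib

namespace PieceSep

universe u v w

/-- `w` and `w'` have the same pieces (scattered subwords, i.e. sublists) of size at most `k`. -/
def PieceEq {A : Type u} (k : ℕ) (w w' : List A) : Prop :=
  ∀ x : List A, x.length ≤ k → (x.Sublist w ↔ x.Sublist w')

/-- `L` is a union of classes of `PieceEq k`: membership in `L` depends only on the pieces
of size at most `k`. -/
def HasIndex {A : Type u} (k : ℕ) (L : Language A) : Prop :=
  ∀ w w' : List A, PieceEq k w w' → (w ∈ L ↔ w' ∈ L)

/-- The class of piecewise testable languages of index `k` or less. -/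
def PTIndex (A : Type u) (k : ℕ) : Set (Language A) :=
  {L | ∃ j ≤ k, HasIndex j L}

/-- The class of all piecewise testable languages. -/
def PT (A : Type u) : Set (Language A) :=
  ⋃ k : ℕ, PTIndex A k

/-- `L` separates `L₁` from `L₂`. -/
def Separates {A : Type u} (L L₁ L₂ : Language A) : Prop :=
  L₁ ≤ L ∧ L₂ ⊓ L = ⊥

/-- Some language of the class `S` separates `L₁` from `L₂`. -/
def Separable {A : Type u} (S : Set (Language A)) (L₁ L₂ : Language A) : Prop :=
  ∃ L ∈ S, Separates L L₁ L₂

/-- The `k`-piece closure of `L`. -/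
def pieceClosure {A : Type u} (L : Language A) (k : ℕ) : Language A :=
  {w | ∃ x ∈ L, PieceEq k x w}

/-- A path from `p` to `q` labeled `x`. -/
def HasPath {A : Type u} {Q : Type v} (M : NFA A Q) (p q : Q) (x : List A) : Prop :=
  Nonempty (M.Path p q x)

/-- A path from `p` to `q` of which all transitions are labeled over `B`. -/
def HasPathIn {A : Type u} {Q : Type v} (M : NFA A Q) (p q : Q) (B : Set A) : Prop :=
  ∃ x : List A, (∀ a ∈ x, a ∈ B) ∧ HasPath M p q x

/-- A path from `p` to `q` of which all transitions are labeled over `B`, and along which every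
letter of `B` occurs at least once. -/
def HasPathOnto {A : Type u} {Q : Type v} (M : NFA A Q) (p q : Q) (B : Set A) : Prop :=
  ∃ x : List A, (∀ a ∈ x, a ∈ B) ∧ (∀ a ∈ B, a ∈ x) ∧ HasPath M p q x

/-- A factorization pair: words `u₀, …, uₙ` and nonempty subalphabets `B₁, …, Bₙ` (`n ≥ 0`);
the field `alph i` is `B_{i+1}`. -/
structure FactorizationPair (A : Type u) where
  n : ℕ
  word : Fin (n + 1) → List A
  alph : Fin n → Set A
  alph_nonempty : ∀ i, (alph i).Nonempty

/-- `M` has a `(u, B)`-path: a successful path that reads `uᵢ` from `s i` to `t i`, and between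
`t i` and `s (i + 1)` has the shape `t i --(⊆ B)--> r i --(= B)--> r i --(⊆ B)--> s (i + 1)` with
`B = B_{i+1}`. -/
def HasUBPath {A : Type u} {Q : Type v} (M : NFA A Q) (P : FactorizationPair A) : Prop :=
  ∃ (s t : Fin (P.n + 1) → Q) (r : Fin P.n → Q),
    s 0 ∈ M.start ∧ t (Fin.last P.n) ∈ M.accept ∧
    (∀ i, HasPath M (s i) (t i) (P.word i)) ∧
    ∀ i : Fin P.n,
      HasPathIn M (t i.castSucc) (r i) (P.alph i) ∧
      HasPathOnto M (r i) (r i) (P.alph i) ∧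
      HasPathIn M (r i) (s i.succ) (P.alph i)

/-- A factorization pair is a witness of non-separability for `(M₁, M₂)` when both automata have
a path of its shape. -/
def IsNonSepWitness {A : Type u} {Q₁ : Type v} {Q₂ : Type w} (M₁ : NFA A Q₁) (M₂ : NFA A Q₂)
    (P : FactorizationPair A) : Prop :=
  HasUBPath M₁ P ∧ HasUBPath M₂ P

end PieceSep

/-! A word made of `k` blocks over `B`, each containing every letter of `B`, has all words over `B`
of size at most `k` as pieces. Pumping the loops of a common witness therefore produces, for every
`k`, words of `L₁` and `L₂` with the same pieces of size at most `k`, so no piecewise testable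
language separates them.

Conversely, let `x ∈ L₁` and `y ∈ L₂` have the same pieces of size at most `κ`. A template, a
product of letters and stars `B*`, defines a downward closed language (`InIdeal`), and pieces of
size one more than its length decide membership in it (`inIdeal_of_forall_piece`). Start from the
template `A*`, which contains both words. If one word is not rich over some star, or skips a letter,
it lies in the ideal of a lighter template (`InIdeal.implements_or_exists`), and so does the other
word. The weight decreases, so the descent ends at a template that both words implement with
richness `p`. As `p` is at least the number of states, the pigeonhole principle finds a loop over
each star (`Rich.exists_loop`), hence a common witness. The descent only needs `κ ≥ (2p)^|A| + 1`.
-/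

namespace PieceSep

universe u v w

variable {A : Type u} {Q : Type v} {Q₁ : Type v} {Q₂ : Type w}

/-! ### Paths in an automaton -/

section Paths

variable {M : NFA A Q} {p q r : Q} {B : Set A}

theorem HasPath.nil (p : Q) : HasPath M p p [] := ⟨.nil p⟩

theorem HasPath.cons {x : List A} {a : A} (h : q ∈ M.step p a) (hx : HasPath M q r x) :
    HasPath M p r (a :: x) :=
  hx.elim fun π => ⟨.cons q p r a x h π⟩

theorem hasPath_cons {x : List A} {a : A} :
    HasPath M p r (a :: x) ↔ ∃ q ∈ M.step p a, HasPath M q r x := by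
  constructor
  · rintro ⟨_ | ⟨q, _, _, _, _, h, π⟩⟩
    exact ⟨q, h, ⟨π⟩⟩
  · rintro ⟨q, h, hx⟩
    exact hx.cons h

theorem hasPath_nil : HasPath M p q [] ↔ p = q := by
  constructor
  · rintro ⟨π⟩
    cases π
    rfl
  · rintro rfl
    exact .nil p

theorem hasPath_append {x y : List A} :
    HasPath M p r (x ++ y) ↔ ∃ q, HasPath M p q x ∧ HasPath M q r y := by
  induction x generalizing p with
  | nil => simp [hasPath_nil]
  | cons a x ih =>
    simp only [List.cons_append, hasPath_cons, ih]
    constructor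
    · rintro ⟨s, hs, q, h₁, h₂⟩
      exact ⟨q, ⟨s, hs, h₁⟩, h₂⟩
    · rintro ⟨q, ⟨s, hs, h₁⟩, h₂⟩
      exact ⟨s, hs, q, h₁, h₂⟩

theorem HasPath.append {x y : List A} (hx : HasPath M p q x) (hy : HasPath M q r y) :
    HasPath M p r (x ++ y) :=
  hasPath_append.2 ⟨q, hx, hy⟩

theorem HasPathIn.refl (p : Q) : HasPathIn M p p B := ⟨[], by simp, .nil p⟩

theorem HasPathIn.trans (h₁ : HasPathIn M p q B) (h₂ : HasPathIn M q r B) :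
    HasPathIn M p r B := by
  obtain ⟨x, hx, px⟩ := h₁
  obtain ⟨y, hy, py⟩ := h₂
  exact ⟨x ++ y, by simpa [or_imp, forall_and] using ⟨hx, hy⟩, px.append py⟩

theorem HasPathOnto.hasPathIn (h : HasPathOnto M p q B) : HasPathIn M p q B := by
  obtain ⟨x, hx, -, px⟩ := h
  exact ⟨x, hx, px⟩

theorem HasPathOnto.trans_hasPathIn (h₁ : HasPathOnto M p q B) (h₂ : HasPathIn M q r B) :
    HasPathOnto M p r B := by
  obtain ⟨x, hx, hB, px⟩ := h₁
  obtain ⟨y, hy, py⟩ := h₂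
  exact ⟨x ++ y, by simpa [or_imp, forall_and] using ⟨hx, hy⟩,
    fun a ha => List.mem_append_left _ (hB a ha), px.append py⟩

end Paths

/-! ### Pieces, rich words and pumping -/

section Pieces

theorem PieceEq.symm {k : ℕ} {x y : List A} (h : PieceEq k x y) : PieceEq k y x :=
  fun z hz => (h z hz).symm

theorem PieceEq.trans {k : ℕ} {x y z : List A} (h₁ : PieceEq k x y) (h₂ : PieceEq k y z) :
    PieceEq k x z :=
  fun t ht => (h₁ t ht).trans (h₂ t ht)

theorem PieceEq.append {k : ℕ} {x x' y y' : List A} (hx : PieceEq k x x')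
    (hy : PieceEq k y y') : PieceEq k (x ++ y) (x' ++ y') := by
  intro z hz
  simp only [List.sublist_append_iff]
  constructor <;>
  · rintro ⟨a, b, rfl, ha, hb⟩
    rw [List.length_append] at hz
    refine ⟨a, b, rfl, ?_, ?_⟩
    · first | exact (hx a (by omega)).1 ha | exact (hx a (by omega)).2 ha
    · first | exact (hy b (by omega)).1 hb | exact (hy b (by omega)).2 hb

/-- `z` is a word over `B` with `n` successive factors in each of which all letters of `B`
occur. -/
def Rich (B : Set A) : ℕ → List A → Prop
  | 0, z => ∀ a ∈ z, a ∈ B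
  | n + 1, z => ∃ x y, z = x ++ y ∧ (∀ a ∈ x, a ∈ B) ∧ (∀ a ∈ B, a ∈ x) ∧ Rich B n y

theorem Rich.subset {B : Set A} {n : ℕ} {z : List A} (h : Rich B n z) : ∀ a ∈ z, a ∈ B := by
  induction n generalizing z with
  | zero => exact h
  | succ n ih =>
    obtain ⟨x, y, rfl, hx, -, hy⟩ := h
    simpa [or_imp, forall_and] using ⟨hx, ih hy⟩

theorem Rich.append_left {B : Set A} {n : ℕ} {x z : List A} (h : Rich B n z)
    (hx : ∀ a ∈ x, a ∈ B) : Rich B n (x ++ z) := by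
  cases n with
  | zero => simpa [Rich, or_imp, forall_and] using ⟨hx, h⟩
  | succ n =>
    obtain ⟨y, z, rfl, hy, hB, hz⟩ := h
    exact ⟨x ++ y, z, by simp, by simpa [or_imp, forall_and] using ⟨hx, hy⟩,
      fun a ha => List.mem_append_right _ (hB a ha), hz⟩

theorem Rich.append_right {B : Set A} {n : ℕ} {x z : List A} (h : Rich B n z)
    (hx : ∀ a ∈ x, a ∈ B) : Rich B n (z ++ x) := by
  induction n generalizing z with
  | zero => simpa [Rich, or_imp, forall_and] using ⟨h, hx⟩
  | succ n ih =>
    obtain ⟨y, z, rfl, hy, hB, hz⟩ := h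
    exact ⟨y, z ++ x, by simp, hy, hB, ih hz⟩

/-- The `i`-th letter of `x` is found in the `i`-th block. -/
theorem Rich.sublist {B : Set A} {n : ℕ} {x z : List A} (h : Rich B n z)
    (hx : ∀ a ∈ x, a ∈ B) (hn : x.length ≤ n) : x.Sublist z := by
  induction n generalizing x z with
  | zero => simp_all
  | succ n ih =>
    obtain ⟨y, z, rfl, -, hB, hz⟩ := h
    cases x with
    | nil => simp
    | cons a x =>
      have ha : [a].Sublist y := by simpa using hB a (hx a (by simp))
      exact ha.append (ih hz (fun b hb => hx b (by simp [hb])) (by simpa using hn))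

theorem Rich.pieceEq {B : Set A} {n : ℕ} {x y : List A} (hx : Rich B n x) (hy : Rich B n y) :
    PieceEq n x y := fun _ hz =>
  ⟨fun h => hy.sublist (fun a ha => hx.subset a (h.subset ha)) hz,
    fun h => hx.sublist (fun a ha => hy.subset a (h.subset ha)) hz⟩

theorem HasPathOnto.exists_rich_loop {M : NFA A Q} {r : Q} {B : Set A}
    (h : HasPathOnto M r r B) (n : ℕ) : ∃ z, HasPath M r r z ∧ Rich B n z := by
  induction n with
  | zero => exact ⟨[], .nil r, by simp [Rich]⟩
  | succ n ih =>
    obtain ⟨z, hz, hr⟩ := ih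
    obtain ⟨x, hx, hB, px⟩ := h
    exact ⟨x ++ z, px.append hz, x, z, rfl, hx, hB, hr⟩

theorem exists_rich_path {M : NFA A Q} {t r s : Q} {B : Set A} (h₁ : HasPathIn M t r B)
    (h₂ : HasPathOnto M r r B) (h₃ : HasPathIn M r s B) (n : ℕ) :
    ∃ z, HasPath M t s z ∧ Rich B n z := by
  obtain ⟨x, hx, px⟩ := h₁
  obtain ⟨y, py, hy⟩ := h₂.exists_rich_loop n
  obtain ⟨z, hz, pz⟩ := h₃
  exact ⟨x ++ y ++ z, (px.append py).append pz, (hy.append_left hx).append_right hz⟩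

/-- Two automata with a common witness accept words that are indistinguishable by pieces of any
given size. -/
theorem IsNonSepWitness.exists_pieceEq {M₁ : NFA A Q₁} {M₂ : NFA A Q₂}
    {P : FactorizationPair A} (h : IsNonSepWitness M₁ M₂ P) (k : ℕ) :
    ∃ x ∈ M₁.accepts, ∃ y ∈ M₂.accepts, PieceEq k x y := by
  obtain ⟨⟨s, t, r, hs, ht, hw, hB⟩, ⟨s', t', r', hs', ht', hw', hB'⟩⟩ := h
  have key : ∀ i, ∃ x y, HasPath M₁ (s 0) (t i) x ∧ HasPath M₂ (s' 0) (t' i) y ∧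
      PieceEq k x y := by
    intro i
    induction i using Fin.induction with
    | zero => exact ⟨_, _, hw 0, hw' 0, fun _ _ => Iff.rfl⟩
    | succ i ih =>
      obtain ⟨x, y, hx, hy, hxy⟩ := ih
      obtain ⟨b₁, b₂, b₃⟩ := hB i
      obtain ⟨c₁, c₂, c₃⟩ := hB' i
      obtain ⟨z, pz, hz⟩ := exists_rich_path b₁ b₂ b₃ k
      obtain ⟨z', pz', hz'⟩ := exists_rich_path c₁ c₂ c₃ k
      exact ⟨_, _, (hx.append pz).append (hw i.succ), (hy.append pz').append (hw' i.succ),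
        (hxy.append (hz.pieceEq hz')).append fun _ _ => Iff.rfl⟩
  obtain ⟨x, y, hx, hy, hxy⟩ := key (Fin.last _)
  exact ⟨x, NFA.accepts_iff_exists_path.2 ⟨_, hs, _, ht, hx⟩,
    y, NFA.accepts_iff_exists_path.2 ⟨_, hs', _, ht', hy⟩, hxy⟩

end Pieces

/-! ### Templates, their ideals, and descent on the weight -/

section Templates

/-- A factor of a template: a letter, or a set of letters. -/
inductive Factor (A : Type u) : Type u
  | letter (a : A) : Factor A
  | star (B : Finset A) : Factor A

/-- The downward closed language of the product over `T` of the factors `{ε, a}` for a letter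
`a` and `B*` for a set `B`. -/
def InIdeal : List (Factor A) → List A → Prop
  | [], w => w = []
  | .letter a :: T, w => InIdeal T w ∨ ∃ x, w = a :: x ∧ InIdeal T x
  | .star B :: T, w => ∃ z x, w = z ++ x ∧ (∀ a ∈ z, a ∈ B) ∧ InIdeal T x

/-- `w` is a product of the letters of `T` and of words that are rich over the (nonempty) sets
of `T`. -/
def Implements (p : ℕ) : List (Factor A) → List A → Prop
  | [], w => w = []
  | .letter a :: T, w => ∃ x, w = a :: x ∧ Implements p T x
  | .star B :: T, w => B.Nonempty ∧ ∃ z x, w = z ++ x ∧ Rich (B : Set A) p z ∧ Implements p T x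

theorem inIdeal_nil (T : List (Factor A)) : InIdeal T [] := by
  induction T with
  | nil => rfl
  | cons f T ih =>
    cases f with
    | letter a => exact .inl ih
    | star B => exact ⟨[], [], rfl, by simp, ih⟩

theorem InIdeal.of_sublist {T : List (Factor A)} {x y : List A} (hy : InIdeal T y)
    (h : x.Sublist y) : InIdeal T x := by
  induction T generalizing x y with
  | nil =>
    cases hy
    simpa [InIdeal] using h
  | cons f T ih =>
    cases f with
    | letter a =>
      rcases hy with hy | ⟨y, rfl, hy⟩
      · exact .inl (ih hy h)
      · rcases List.sublist_cons_iff.1 h with hs | ⟨x, rfl, hs⟩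
        · exact .inl (ih hy hs)
        · exact .inr ⟨x, rfl, ih hy hs⟩
    | star B =>
      obtain ⟨z, y, rfl, hz, hy⟩ := hy
      obtain ⟨z', x, rfl, hz', hx⟩ := List.sublist_append_iff.1 h
      exact ⟨z', x, rfl, fun a ha => hz a (hz'.subset ha), ih hy hx⟩

theorem InIdeal.append {S T : List (Factor A)} {x y : List A} (hx : InIdeal S x)
    (hy : InIdeal T y) : InIdeal (S ++ T) (x ++ y) := by
  induction S generalizing x with
  | nil =>
    cases hx
    exact hy
  | cons f S ih =>
    cases f with
    | letter a =>
      rcases hx with hx | ⟨x, rfl, hx⟩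
      · exact .inl (ih hx)
      · exact .inr ⟨x ++ y, rfl, ih hx⟩
    | star B =>
      obtain ⟨z, x, rfl, hz, hx⟩ := hx
      exact ⟨z, x ++ y, by simp, hz, ih hx⟩

/-- Membership in the ideal of `T` is determined by the pieces of size at most
`T.length + 1`. -/
theorem inIdeal_of_forall_piece {T : List (Factor A)} {w : List A}
    (h : ∀ x : List A, x.length ≤ T.length + 1 → x.Sublist w → InIdeal T x) : InIdeal T w := by
  induction T generalizing w with
  | nil =>
    cases w with
    | nil => rfl
    | cons b w =>
      have := h [b] (by simp) (by simp)
      simp [InIdeal] at this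
  | cons f T ih =>
    cases f with
    | letter a =>
      cases w with
      | nil => exact inIdeal_nil _
      | cons b w =>
        by_cases hab : b = a
        · subst hab
          refine .inr ⟨w, rfl, ih fun x hx hxw => ?_⟩
          rcases h (b :: x) (by simpa using hx) (hxw.cons_cons b) with h | ⟨y, hy, h⟩
          · exact h.of_sublist (List.sublist_cons_self _ _)
          · cases hy
            exact h
        -- The head `b` cannot use the factor `a`. If `x = a :: y` did use it, then `b :: a :: y`
        -- would still be a short enough piece, and its `b` forces all of it into the ideal of `T`.
        · refine .inl (ih fun x hx hxw => ?_)
          rcases h x (by simp only [List.length_cons]; omega) hxw with hx' | ⟨y, rfl, hy⟩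
          · exact hx'
          · have hs : (a :: y).Sublist w := by
              rcases List.sublist_cons_iff.1 hxw with h | ⟨_, h, _⟩
              · exact h
              · exact absurd (List.cons.inj h).1.symm hab
            rcases h (b :: a :: y) (by simpa using hx) (hs.cons_cons b) with h | ⟨_, h, _⟩
            · exact h.of_sublist (List.sublist_cons_self _ _)
            · exact absurd (List.cons.inj h).1 hab
    | star B =>
      induction w with
      | nil => exact inIdeal_nil _
      | cons b w ihw =>
        by_cases hb : b ∈ B
        · obtain ⟨z, x, rfl, hz, hx⟩ := ihw fun x hx hxw => h x hx (hxw.cons b)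
          exact ⟨b :: z, x, rfl, by simpa using ⟨hb, hz⟩, hx⟩
        -- A word starting with `b ∉ B` takes nothing from `B*`.
        · have drop : ∀ y, InIdeal (.star B :: T) (b :: y) → InIdeal T (b :: y) := by
            rintro y ⟨z, x, hzx, hz, hx⟩
            cases z with
            | nil => simpa [hzx] using hx
            | cons c z =>
              obtain ⟨rfl, -⟩ := List.cons.inj hzx
              exact absurd (hz b (by simp)) hb
          refine ⟨[], b :: w, rfl, by simp, ih fun x hx hxw => ?_⟩
          rcases List.sublist_cons_iff.1 hxw with hs | ⟨y, rfl, hs⟩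
          · exact (drop x (h _ (by simpa using hx) (hs.cons_cons b))).of_sublist
              (List.sublist_cons_self _ _)
          · exact drop y (h _ (by simp only [List.length_cons] at hx ⊢; omega) hxw)

theorem PieceEq.inIdeal {k : ℕ} {T : List (Factor A)} {x y : List A} (h : PieceEq k x y)
    (hk : T.length + 1 ≤ k) (hx : InIdeal T x) : InIdeal T y :=
  inIdeal_of_forall_piece fun z hz hzy => hx.of_sublist ((h z (hz.trans hk)).2 hzy)

/-- The weight of a set of `k` letters. -/
def starWeight (p : ℕ) : ℕ → ℕ
  | 0 => 1
  | k + 1 => p * (starWeight p k + 1)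

/-- The weight of a factor. -/
def Factor.weight (p : ℕ) : Factor A → ℕ
  | .letter _ => 1
  | .star B => starWeight p B.card

/-- The weight of a template. -/
def weight (p : ℕ) (T : List (Factor A)) : ℕ := (T.map (Factor.weight p)).sum

@[simp]
theorem weight_nil (p : ℕ) : weight p ([] : List (Factor A)) = 0 := rfl

@[simp]
theorem weight_letter_cons (p : ℕ) (a : A) (T : List (Factor A)) :
    weight p (.letter a :: T) = 1 + weight p T := rfl

@[simp]
theorem weight_star_cons (p : ℕ) (B : Finset A) (T : List (Factor A)) :
    weight p (.star B :: T) = starWeight p B.card + weight p T := rfl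

theorem weight_append (p : ℕ) (S T : List (Factor A)) :
    weight p (S ++ T) = weight p S + weight p T := by
  simp [weight]

theorem starWeight_pos {p : ℕ} (hp : 0 < p) (k : ℕ) : 0 < starWeight p k := by
  cases k with
  | zero => simp [starWeight]
  | succ k => simp [starWeight, hp]

theorem starWeight_le {p : ℕ} (hp : 0 < p) (k : ℕ) : starWeight p k ≤ (2 * p) ^ k := by
  induction k with
  | zero => simp [starWeight]
  | succ k ih =>
    have := starWeight_pos hp k
    calc p * (starWeight p k + 1) ≤ p * (2 * starWeight p k) := by gcongr; omega
      _ ≤ p * (2 * (2 * p) ^ k) := by gcongr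
      _ = (2 * p) ^ (k + 1) := by ring

theorem length_le_weight {p : ℕ} (hp : 0 < p) (T : List (Factor A)) :
    T.length ≤ weight p T := by
  induction T with
  | nil => simp
  | cons f T ih =>
    cases f with
    | letter a => simp; omega
    | star B =>
      have := starWeight_pos hp B.card
      simp; omega

/-- The shortest prefix containing all of `B` ends with the first occurrence of its last letter. -/
theorem exists_minimal_prefix {B : Finset A} (hB : B.Nonempty) {z : List A}
    (hz : ∀ a ∈ B, a ∈ z) :
    ∃ x a y, z = x ++ a :: y ∧ a ∉ x ∧ ∀ b ∈ B, b ∈ x ++ [a] := by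
  induction z using List.reverseRecOn with
  | nil =>
    obtain ⟨b, hb⟩ := hB
    simpa using hz b hb
  | append_singleton z c ih =>
    by_cases h : ∀ a ∈ B, a ∈ z
    · obtain ⟨x, a, y, rfl, ha, hx⟩ := ih h
      exact ⟨x, a, y ++ [c], by simp, ha, hx⟩
    · push Not at h
      obtain ⟨b, hb, hbz⟩ := h
      obtain rfl : b = c := by simpa [hbz] using hz b hb
      exact ⟨z, b, [], rfl, hbz, hz⟩

/-- A word over `B` that is not rich lies in the ideal of a template over smaller sets. -/
theorem exists_inIdeal_of_not_rich [DecidableEq A] {B : Finset A} (hB : B.Nonempty) (p n : ℕ)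
    {z : List A} (hz : ∀ a ∈ z, a ∈ B) (h : ¬ Rich (B : Set A) n z) :
    ∃ T, InIdeal T z ∧ weight p T < n * (starWeight p (B.card - 1) + 1) := by
  induction n generalizing z with
  | zero => exact absurd hz h
  | succ n ih =>
    by_cases hBz : ∀ a ∈ B, a ∈ z
    · obtain ⟨x, a, y, rfl, hax, hBx⟩ := exists_minimal_prefix hB hBz
      have ha : a ∈ B := hz a (by simp)
      have hy : ¬ Rich (B : Set A) n y := fun hy =>
        h ⟨x ++ [a], y, by simp, fun b hb => hz b (by simp at hb ⊢; tauto), hBx, hy⟩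
      obtain ⟨T, hT, hw⟩ := ih (fun b hb => hz b (by simp [hb])) hy
      -- Each complete block costs a star on one letter fewer, plus the letter that completes it.
      -- The final incomplete block costs only a star, whence the strict inequality.
      refine ⟨.star (B.erase a) :: .letter a :: T,
        ⟨x, a :: y, rfl, fun b hb => ?_, .inr ⟨y, rfl, hT⟩⟩, ?_⟩
      · exact Finset.mem_erase.2 ⟨fun e => hax (e ▸ hb), hz b (by simp [hb])⟩
      · simp only [weight_star_cons, weight_letter_cons, Finset.card_erase_of_mem ha, add_mul]
        omega
    · push Not at hBz
      obtain ⟨b, hb, hbz⟩ := hBz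
      refine ⟨[.star (B.erase b)], ⟨z, [], by simp, fun c hc => ?_, rfl⟩, ?_⟩
      · exact Finset.mem_erase.2 ⟨fun e => hbz (e ▸ hc), hz c hc⟩
      · simp only [weight_star_cons, weight_nil, Finset.card_erase_of_mem hb, add_mul]
        omega

/-- A word of the ideal of `T` implements `T` or lies in the ideal of a lighter template. -/
theorem InIdeal.implements_or_exists {p : ℕ} {T : List (Factor A)} {w : List A}
    (h : InIdeal T w) :
    Implements p T w ∨ ∃ T', weight p T' < weight p T ∧ InIdeal T' w := by
  classical
  induction T generalizing w with
  | nil => exact .inl h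
  | cons f T ih =>
    cases f with
    | letter a =>
      rcases h with h | ⟨x, rfl, h⟩
      · exact .inr ⟨T, by simp, h⟩
      · rcases ih h with h | ⟨T', hT, h⟩
        · exact .inl ⟨x, rfl, h⟩
        · exact .inr ⟨.letter a :: T', by simpa using hT, .inr ⟨x, rfl, h⟩⟩
    | star B =>
      obtain ⟨z, x, rfl, hz, h⟩ := h
      rcases ih h with h' | ⟨T', hT, h'⟩
      · rcases B.eq_empty_or_nonempty with rfl | hB
        · obtain rfl : z = [] := List.eq_nil_iff_forall_not_mem.2 fun a ha => by simpa using hz a ha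
          -- A star over the empty set has weight 1, so deleting it lightens the template.
          exact .inr ⟨T, by simp [starWeight], h⟩
        · by_cases hr : Rich (B : Set A) p z
          · exact .inl ⟨hB, z, x, rfl, hr, h'⟩
          · obtain ⟨S, hS, hw⟩ := exists_inIdeal_of_not_rich hB p p hz hr
            refine .inr ⟨S ++ T, ?_, hS.append h⟩
            obtain ⟨k, hk⟩ := Nat.exists_eq_succ_of_ne_zero hB.card_pos.ne'
            rw [hk] at hw
            rw [weight_append, weight_star_cons, hk]
            simpa [starWeight] using hw
      · exact .inr ⟨.star B :: T', by simpa using hT, z, x, rfl, hz, h'⟩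

/-- When one word fails to implement `T`, it moves to the ideal of a lighter template. The length of
that template is at most its weight, so pieces of size `k` carry the other word along. -/
theorem PieceEq.exists_implements_of_inIdeal {p k : ℕ} (hp : 0 < p) {x y : List A}
    (h : PieceEq k x y) (T : List (Factor A)) (hk : weight p T + 1 ≤ k) (hx : InIdeal T x)
    (hy : InIdeal T y) : ∃ T, Implements p T x ∧ Implements p T y := by
  induction hn : weight p T using Nat.strong_induction_on generalizing T with
  | _ n ih =>
    subst hn
    rcases hx.implements_or_exists (p := p) with hx | ⟨T', hT, hx⟩
    · rcases hy.implements_or_exists (p := p) with hy | ⟨T', hT, hy⟩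
      · exact ⟨T, hx, hy⟩
      · have := length_le_weight hp T'
        exact ih _ hT T' (by omega) (h.symm.inIdeal (by omega) hy) hy rfl
    · have := length_le_weight hp T'
      exact ih _ hT T' (by omega) hx (h.inIdeal (by omega) hx) rfl

/-- Words with the same pieces of large enough size implement a common template. -/
theorem PieceEq.exists_implements [Fintype A] {p k : ℕ} (hp : 0 < p) {x y : List A}
    (h : PieceEq k x y) (hk : (2 * p) ^ Fintype.card A + 1 ≤ k) :
    ∃ T, Implements p T x ∧ Implements p T y := by
  have hw := starWeight_le hp (Fintype.card A)
  refine h.exists_implements_of_inIdeal hp [.star Finset.univ] ?_ ?_ ?_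
  · simpa [Finset.card_univ] using (Nat.succ_le_succ hw).trans hk
  · exact ⟨x, [], by simp, by simp, rfl⟩
  · exact ⟨y, [], by simp, by simp, rfl⟩

end Templates

/-! ### From implemented templates to common witnesses -/

section Automata

/-- `M` has a path of the shape `P` from `x` to `y`. -/
def HasUBPathFromTo (M : NFA A Q) (P : FactorizationPair A) (x y : Q) : Prop :=
  ∃ (s t : Fin (P.n + 1) → Q) (r : Fin P.n → Q),
    s 0 = x ∧ t (Fin.last P.n) = y ∧
    (∀ i, HasPath M (s i) (t i) (P.word i)) ∧
    ∀ i : Fin P.n,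
      HasPathIn M (t i.castSucc) (r i) (P.alph i) ∧
      HasPathOnto M (r i) (r i) (P.alph i) ∧
      HasPathIn M (r i) (s i.succ) (P.alph i)

theorem HasUBPathFromTo.hasUBPath {M : NFA A Q} {P : FactorizationPair A} {x y : Q}
    (h : HasUBPathFromTo M P x y) (hx : x ∈ M.start) (hy : y ∈ M.accept) : HasUBPath M P := by
  obtain ⟨s, t, r, rfl, rfl, h⟩ := h
  exact ⟨s, t, r, hx, hy, h⟩

/-- The factorization pair of the empty word. -/
def FactorizationPair.nil : FactorizationPair A where
  n := 0
  word := fun _ => []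
  alph := Fin.elim0
  alph_nonempty := fun i => i.elim0

/-- Prepend a letter to the first word of a factorization pair. -/
def FactorizationPair.consLetter (a : A) (P : FactorizationPair A) : FactorizationPair A where
  n := P.n
  word := Fin.cons (a :: P.word 0) fun i => P.word i.succ
  alph := P.alph
  alph_nonempty := P.alph_nonempty

/-- Prepend an empty word and the set `B` to a factorization pair. -/
def FactorizationPair.consStar (B : Set A) (hB : B.Nonempty) (P : FactorizationPair A) :
    FactorizationPair A where
  n := P.n + 1
  word := Fin.cons [] P.word
  alph := Fin.cons B P.alph
  alph_nonempty := Fin.cases hB P.alph_nonempty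

theorem hasUBPathFromTo_nil (M : NFA A Q) (x : Q) : HasUBPathFromTo M .nil x x :=
  ⟨fun _ => x, fun _ => x, Fin.elim0, rfl, rfl, fun _ => .nil x, fun i => i.elim0⟩

theorem HasUBPathFromTo.consLetter {M : NFA A Q} {P : FactorizationPair A} {x y z : Q} {a : A}
    (h : HasUBPathFromTo M P y z) (ha : y ∈ M.step x a) :
    HasUBPathFromTo M (P.consLetter a) x z := by
  obtain ⟨s, t, r, rfl, rfl, hw, hB⟩ := h
  refine ⟨Fin.cons x fun i => s i.succ, t, r, rfl, rfl, fun i => ?_, hB⟩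
  refine Fin.cases ?_ (fun i => ?_) i
  · exact (hw 0).cons ha
  · exact hw i.succ

theorem HasUBPathFromTo.consStar {M : NFA A Q} {P : FactorizationPair A} {x q y z : Q}
    {B : Set A} (h : HasUBPathFromTo M P y z) (hB : B.Nonempty) (h₁ : HasPathIn M x q B)
    (h₂ : HasPathOnto M q q B) (h₃ : HasPathIn M q y B) :
    HasUBPathFromTo M (P.consStar B hB) x z := by
  obtain ⟨s, t, r, rfl, rfl, hw, hB'⟩ := h
  refine ⟨Fin.cons x s, Fin.cons x t, Fin.cons q r, rfl, rfl, fun i => ?_, fun i => ?_⟩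
  · refine Fin.cases ?_ (fun i => ?_) i
    · exact .nil x
    · exact hw i
  · refine Fin.cases ?_ (fun i => ?_) i
    · exact ⟨h₁, h₂, h₃⟩
    · exact hB' i

/-- The states `g i` are those visited at the block boundaries. -/
theorem Rich.exists_states {M : NFA A Q} {B : Set A} {n : ℕ} {z : List A} {x y : Q}
    (hz : Rich B n z) (h : HasPath M x y z) :
    ∃ g : ℕ → Q, g 0 = x ∧ (∀ i < n, HasPathOnto M (g i) (g (i + 1)) B) ∧
      HasPathIn M (g n) y B := by
  induction n generalizing z x with
  | zero => exact ⟨fun _ => x, rfl, by simp, z, hz, h⟩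
  | succ n ih =>
    obtain ⟨u, v, rfl, hu, hB, hv⟩ := hz
    obtain ⟨q, hxq, hqy⟩ := hasPath_append.1 h
    obtain ⟨g, rfl, hg, hgy⟩ := ih hv hqy
    refine ⟨fun i => i.casesOn x g, rfl, fun i hi => ?_, hgy⟩
    cases i with
    | zero => exact ⟨u, hu, hB, hxq⟩
    | succ i => exact hg i (by omega)

/-- A path labeled by a word that is richer than the number of states goes through a loop along
which all letters occur. -/
theorem Rich.exists_loop [Fintype Q] {M : NFA A Q} {B : Set A} {n : ℕ} {z : List A} {x y : Q}
    (hz : Rich B n z) (hn : Fintype.card Q ≤ n) (h : HasPath M x y z) :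
    ∃ r, HasPathIn M x r B ∧ HasPathOnto M r r B ∧ HasPathIn M r y B := by
  obtain ⟨g, rfl, hg, hgy⟩ := hz.exists_states h
  have hin : ∀ i j, i ≤ j → j ≤ n → HasPathIn M (g i) (g j) B := by
    intro i j hij
    induction j, hij using Nat.le_induction with
    | base => exact fun _ => .refl _
    | succ j hij ih => exact fun hj => (ih (by omega)).trans (hg j (by omega)).hasPathIn
  obtain ⟨i, j, hij, he⟩ : ∃ i j : Fin (n + 1), i < j ∧ g i = g j := by
    obtain ⟨i, j, hne, he⟩ := Fintype.exists_ne_map_eq_of_card_lt (fun i : Fin (n + 1) => g i)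
      (by simpa using Nat.lt_succ_of_le hn)
    rcases lt_or_gt_of_ne hne with h | h
    · exact ⟨i, j, h, he⟩
    · exact ⟨j, i, h, he.symm⟩
  have hij' : (i : ℕ) < j := hij
  have hj := j.is_le
  refine ⟨g i, hin 0 i (by omega) (by omega), ?_, (hin i n (by omega) le_rfl).trans hgy⟩
  -- Since `i < j`, the loop contains at least one full block, so it reads every letter of `B`.
  have := (hg i (by omega)).trans_hasPathIn (hin (i + 1) j (by omega) (by omega))
  rwa [← he] at this

/-- Every template has a factorization pair such that automata with few states have a path of
its shape between the end points of any path whose label implements the template. -/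
theorem exists_factorizationPair [Fintype Q₁] [Fintype Q₂] (M₁ : NFA A Q₁) (M₂ : NFA A Q₂)
    {p : ℕ} (h₁ : Fintype.card Q₁ ≤ p) (h₂ : Fintype.card Q₂ ≤ p) {T : List (Factor A)}
    {w₁ w₂ : List A} {x₁ y₁ : Q₁} {x₂ y₂ : Q₂} (hw₁ : Implements p T w₁)
    (hw₂ : Implements p T w₂) (π₁ : HasPath M₁ x₁ y₁ w₁) (π₂ : HasPath M₂ x₂ y₂ w₂) :
    ∃ P, HasUBPathFromTo M₁ P x₁ y₁ ∧ HasUBPathFromTo M₂ P x₂ y₂ := by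
  induction T generalizing w₁ w₂ x₁ x₂ with
  | nil =>
    cases hw₁
    cases hw₂
    cases hasPath_nil.1 π₁
    cases hasPath_nil.1 π₂
    exact ⟨.nil, hasUBPathFromTo_nil _ _, hasUBPathFromTo_nil _ _⟩
  | cons f T ih =>
    cases f with
    | letter a =>
      obtain ⟨w₁, rfl, hw₁⟩ := hw₁
      obtain ⟨w₂, rfl, hw₂⟩ := hw₂
      obtain ⟨q₁, hq₁, π₁⟩ := hasPath_cons.1 π₁
      obtain ⟨q₂, hq₂, π₂⟩ := hasPath_cons.1 π₂
      obtain ⟨P, hP₁, hP₂⟩ := ih hw₁ hw₂ π₁ π₂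
      exact ⟨P.consLetter a, hP₁.consLetter hq₁, hP₂.consLetter hq₂⟩
    | star B =>
      obtain ⟨hB, z₁, w₁, rfl, hz₁, hw₁⟩ := hw₁
      obtain ⟨-, z₂, w₂, rfl, hz₂, hw₂⟩ := hw₂
      obtain ⟨q₁, hq₁, π₁⟩ := hasPath_append.1 π₁
      obtain ⟨q₂, hq₂, π₂⟩ := hasPath_append.1 π₂
      obtain ⟨P, hP₁, hP₂⟩ := ih hw₁ hw₂ π₁ π₂
      obtain ⟨r₁, a₁, b₁, c₁⟩ := hz₁.exists_loop h₁ hq₁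
      obtain ⟨r₂, a₂, b₂, c₂⟩ := hz₂.exists_loop h₂ hq₂
      exact ⟨P.consStar B hB, hP₁.consStar hB a₁ b₁ c₁, hP₂.consStar hB a₂ b₂ c₂⟩

theorem exists_isNonSepWitness [Fintype Q₁] [Fintype Q₂] {M₁ : NFA A Q₁} {M₂ : NFA A Q₂}
    {p : ℕ} (h₁ : Fintype.card Q₁ ≤ p) (h₂ : Fintype.card Q₂ ≤ p) {T : List (Factor A)}
    {w₁ w₂ : List A} (hw₁ : Implements p T w₁) (hw₂ : Implements p T w₂)
    (ha₁ : w₁ ∈ M₁.accepts) (ha₂ : w₂ ∈ M₂.accepts) : ∃ P, IsNonSepWitness M₁ M₂ P := by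
  obtain ⟨x₁, hx₁, y₁, hy₁, π₁⟩ := NFA.accepts_iff_exists_path.1 ha₁
  obtain ⟨x₂, hx₂, y₂, hy₂, π₂⟩ := NFA.accepts_iff_exists_path.1 ha₂
  obtain ⟨P, hP₁, hP₂⟩ := exists_factorizationPair M₁ M₂ h₁ h₂ hw₁ hw₂ π₁ π₂
  exact ⟨P, hP₁.hasUBPath hx₁ hy₁, hP₂.hasUBPath hx₂ hy₂⟩

end Automata

/-! ### Separation, the bound on `κ`, and the theorem -/

theorem separates_iff {L L₁ L₂ : Language A} :
    Separates L L₁ L₂ ↔ (∀ x ∈ L₁, x ∈ L) ∧ ∀ x ∈ L₂, x ∉ L := by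
  refine and_congr Iff.rfl ⟨fun h x hx hL => ?_, fun h => ?_⟩
  · have : x ∈ L₂ ⊓ L := Language.mem_inf.2 ⟨hx, hL⟩
    rw [h] at this
    exact this
  · exact eq_bot_iff.2 fun x hx => h x (Language.mem_inf.1 hx).1 (Language.mem_inf.1 hx).2

theorem pieceClosure_mem_PTIndex (L : Language A) (k : ℕ) : pieceClosure L k ∈ PTIndex A k :=
  ⟨k, le_rfl, fun _ _ h => ⟨fun ⟨x, hx, hxw⟩ => ⟨x, hx, hxw.trans h⟩,
    fun ⟨x, hx, hxw⟩ => ⟨x, hx, hxw.trans h.symm⟩⟩⟩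

/-- Since `p ≤ 2 ^ p`, the left power is at most `2 ^ ((p + 1) * n)`, and it suffices to compare
exponents. At `n = 0` the right side vanishes. -/
theorem two_mul_pow_succ_le {p n : ℕ} (hp : 0 < p) (hn : 0 < n) :
    (2 * p) ^ n + 1 ≤ p * n * 2 ^ (2 ^ n * n * (p * n + 1)) := by
  have h₁ : (2 * p) ^ n ≤ 2 ^ ((p + 1) * n) := by
    rw [pow_mul]
    gcongr
    rw [pow_succ']
    gcongr
    exact Nat.lt_two_pow_self.le
  have h₂ : (p + 1) * n + 1 ≤ 2 ^ n * n * (p * n + 1) := by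
    have h2 : 2 ≤ 2 ^ n := by simpa using Nat.pow_le_pow_right two_pos hn
    have h3 : p + 1 ≤ p * n + 1 := by gcongr; exact Nat.le_mul_of_pos_right p hn
    calc (p + 1) * n + 1 ≤ 2 * n * (p + 1) := by nlinarith [Nat.mul_pos hp hn]
      _ ≤ 2 ^ n * n * (p * n + 1) := by gcongr
  have h₃ : 1 ≤ 2 ^ ((p + 1) * n) := Nat.one_le_two_pow
  calc (2 * p) ^ n + 1 ≤ 2 ^ ((p + 1) * n) + 2 ^ ((p + 1) * n) := by gcongr
    _ = 2 ^ ((p + 1) * n + 1) := by ring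
    _ ≤ 2 ^ (2 ^ n * n * (p * n + 1)) := by gcongr; norm_num
    _ ≤ p * n * 2 ^ (2 ^ n * n * (p * n + 1)) := Nat.le_mul_of_pos_left _ (by positivity)

end PieceSep

open PieceSep

theorem theorem1 {A : Type*} [Fintype A] {Q₁ Q₂ : Type*} [Fintype Q₁] [Fintype Q₂]
    (M₁ : NFA A Q₁) (M₂ : NFA A Q₂) (p κ : ℕ)
    (hp : p = max (Fintype.card Q₁) (Fintype.card Q₂) + 1)
    (hκ : κ = p * Fintype.card A *
      2 ^ (2 ^ Fintype.card A * Fintype.card A * (p * Fintype.card A + 1))) :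
    List.TFAE
      [PieceSep.Separable (PieceSep.PT A) M₁.accepts M₂.accepts,
       PieceSep.Separable (PieceSep.PTIndex A κ) M₁.accepts M₂.accepts,
       PieceSep.Separates (PieceSep.pieceClosure M₁.accepts κ) M₁.accepts M₂.accepts,
       ¬ ∃ P : PieceSep.FactorizationPair A, PieceSep.IsNonSepWitness M₁ M₂ P] := by
  tfae_have 3 → 2 := fun h => ⟨_, pieceClosure_mem_PTIndex _ _, h⟩
  tfae_have 2 → 1 := fun ⟨L, hL, h⟩ => ⟨L, Set.mem_iUnion.2 ⟨κ, hL⟩, h⟩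
  tfae_have 1 → 4 := by
    rintro ⟨L, hL, h⟩ ⟨P, hP⟩
    obtain ⟨k, j, -, hj⟩ := Set.mem_iUnion.1 hL
    obtain ⟨h₁, h₂⟩ := separates_iff.1 h
    obtain ⟨x, hx, y, hy, hxy⟩ := hP.exists_pieceEq j
    exact h₂ y hy ((hj x y hxy).1 (h₁ x hx))
  tfae_have 4 → 3 := by
    refine fun h => separates_iff.2
      ⟨fun x hx => ⟨x, hx, fun _ _ => Iff.rfl⟩, fun y hy ⟨x, hx, hxy⟩ => h ?_⟩
    have hp₀ : 0 < p := by omega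
    obtain ⟨T, hTx, hTy⟩ : ∃ T, Implements p T x ∧ Implements p T y := by
      rcases isEmpty_or_nonempty A with hA | hA
      -- Without letters `κ = 0` and the bound fails, but the only word is empty and implements the
      -- empty template.
      · exact ⟨[], Subsingleton.elim x [], Subsingleton.elim y []⟩
      · exact hxy.exists_implements hp₀ (hκ ▸ two_mul_pow_succ_le hp₀ Fintype.card_pos)
    exact exists_isNonSepWitness (by omega) (by omega) hTx hTy hx hy
  tfae_finish
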